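/- Let $r\ge 1$ be an integer and $d=2r$. In the rank-$r$ Haar-measure encryption of a bit, $\mathtt Q_r$, the key is a Haar-random unitary $U\in\mathcal U(d)$ and the ciphertext of $b\in\{0,1\}$ is the state $U\sigma_bU^*$ on $\mathbb C^d$, where $\sigma_b=\frac1r\sum_{j=rb}^{r(b+1)-1}|j\rangle\langle j|$. A telegraphing attack $\mathtt A$ on $\mathtt Q_r$ consists of a measurement channel $\Phi(\rho)=\sum_{x\in X}\mathrm{Tr}(P_x\rho)\,|x\rangle\langle x|$, given by a POVM $\{P_x\}_{x\in X}$ on $\mathbb C^d$ with $X$ finite, and, for each key $U$, a two-outcome POVM $\{P^U_0,P^U_1\}$ on $\mathbb C^X$; its winning probability is $$\mathfrak c(\mathtt Q_r|\mathtt A)=\int_{\mathcal U(d)}\tfrac12\sum_{b=0}^1\mathrm{Tr}\big[P^U_b\,\Phi(U\sigma_bU^*)\big]\,dU ,$$ and the (one-copy) telegraphing-distinguishing value $\mathfrak c(\mathtt Q_r|\mathscr M)$ is the supremum of this quantity over all telegraphing attacks. Let $\mathtt A_r$ be the attack in which $\Phi(\rho)=\sum_{i=0}^{d-1}|i\rangle\langle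 i|\rho|i\rangle\langle i|$ is the measurement in the computational basis and $P^U_b=\sum_{i\in G_{b,U}}|i\rangle\langle i|$, where $G_{0,U}=\{i:\langle i|U\sigma_0U^*|i\rangle\ge\langle i|U\sigma_1U^*|i\rangle\}$ and $G_{1,U}$ is its complement. Then $\mathtt A_r$ is a telegraphing attack, and the following hold. 1. For every $r\ge1$, $$\mathfrak c(\mathtt Q_r|\mathtt A_r)=\frac12+\frac1{2^{d+1}}\binom{d}{d/2}.$$ 2. There is a constant $C$ such that for every $r\ge 1$, $$\left|\mathfrak c(\mathtt Q_r|\mathtt A_r)-\frac12-\frac1{\sqrt{2\pi d}}\right|\le\frac{C}{d^{3/2}},$$ that is, $\mathfrak c(\mathtt Q_r|\mathtt A_r)=\frac12+\frac1{\sqrt{2\pi d}}+O(d^{-3/2})$. 3. The one-copy upper bound on the telegraphing-distinguishing value is tight in order: for every $r\ge1$, $$\mathfrak c(\mathtt Q_r|\mathtt A_r)\le\mathfrak c(\mathtt Q_r|\mathscr M)\le\frac12+\frac1{2\sqrt{d+1}},$$ and there is a constant $c>0$ such that $\mathfrak c(\mathtt Q_r|\mathscr M)\ge\frac12+c\cdot\frac{1}{2\sqrt{d+1}}$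 for every $r\ge1$. -/

import Mathlib

open MeasureTheory Matrix
open scoped ComplexOrder

/-! Finite-dimensional Hilbert spaces are `ℂ^A` for a finite register `A`, so operators are complex
matrices indexed by the register. -/

/-- A quantum state (density operator) on `ℂ^H`. -/
structure IsQuantumState {H : Type*} [Fintype H] (ρ : Matrix H H ℂ) : Prop where
  posSemidef : ρ.PosSemidef
  trace_eq_one : ρ.trace = 1

/-- The finite family `P m`, `m ∈ S`, of operators on `ℂ^B` is a POVM. -/
structure IsPOVM {M B : Type*} [Fintype B] [DecidableEq B]
    (S : Finset M) (P : M → Matrix B B ℂ) : Prop where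
  posSemidef : ∀ m ∈ S, (P m).PosSemidef
  sum_eq_one : ∑ m ∈ S, P m = 1

/-- The map `Φ ⊗ id_k` on `𝓑(ℂ^H ⊗ ℂ^k)`: `Φ` applied to each block of a `k × k` block matrix. -/
def tensorId {H B : Type*} (Φ : Matrix H H ℂ →ₗ[ℂ] Matrix B B ℂ) (k : ℕ)
    (X : Matrix (H × Fin k) (H × Fin k) ℂ) : Matrix (B × Fin k) (B × Fin k) ℂ :=
  Matrix.of fun p q => Φ (Matrix.of fun h h' => X (h, p.2) (h', q.2)) p.1 q.1

/-- A quantum channel: a completely positive trace-preserving linear map. -/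
structure IsQuantumChannel {H B : Type*} [Fintype H] [Fintype B]
    (Φ : Matrix H H ℂ →ₗ[ℂ] Matrix B B ℂ) : Prop where
  completelyPositive : ∀ (k : ℕ) (X : Matrix (H × Fin k) (H × Fin k) ℂ),
    X.PosSemidef → (tensorId Φ k X).PosSemidef
  tracePreserving : ∀ ρ : Matrix H H ℂ, (Φ ρ).trace = ρ.trace

/-- A measurement (quantum-to-classical) channel: for some POVM `{P_x}` with outcomes in the output
register, `Φ(ρ) = ∑ₓ Tr(P_x ρ) |x⟩⟨x|`. -/
def IsMeasurementChannel {H B : Type*} [Fintype H] [DecidableEq H] [Fintype B] [DecidableEq B]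
    (Φ : Matrix H H ℂ →ₗ[ℂ] Matrix B B ℂ) : Prop :=
  ∃ P : B → Matrix H H ℂ, IsPOVM Finset.univ P ∧
    ∀ ρ, Φ ρ = ∑ x, (P x * ρ).trace • Matrix.single x x (1 : ℂ)

/-- A quantum encryption of classical messages, with message set `M`, key space `K` and
codespace `ℂ^H`. -/
structure QECM (M K H : Type*) [Fintype M] [MeasurableSpace K] [Fintype H] where
  /-- the key distribution -/
  keyDist : Measure K
  isProbabilityMeasure : IsProbabilityMeasure keyDist
  /-- the ciphertexts `σ^k_m` -/
  cipher : K → M → Matrix H H ℂ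
  isQuantumState : ∀ k m, IsQuantumState (cipher k m)
  measurable_cipher : ∀ m i j, Measurable fun k => cipher k m i j

/-- A one-copy, one-receiver attack `(M₀, ℂ^B, {P^k_m}, Φ)` against a QECM: `Φ` is applied to the
ciphertext, then the receiver learns the key `k` and measures `{P^k_m}` to guess `m ∈ M₀`. -/
structure Attack (M K H B : Type*) [MeasurableSpace K] [Fintype H] [Fintype B]
    [DecidableEq B] where
  /-- the set of messages used in the game -/
  messages : Finset M
  /-- the receiver's POVM for each key -/
  povm : K → M → Matrix B B ℂ
  isPOVM : ∀ k, IsPOVM messages (povm k)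
  measurable_povm : ∀ m ∈ messages, ∀ i j, Measurable fun k => povm k m i j
  /-- the channel applied to the ciphertext -/
  channel : Matrix H H ℂ →ₗ[ℂ] Matrix B B ℂ
  isQuantumChannel : IsQuantumChannel channel

/-- The winning probability
`∫ (1/N) ∑_{m ∈ M₀} Tr(P^k_m Φ(σ^k_m)) dπ(k)`, where `N = |M₀|`.
(The trace is a real number; `re` only changes its type.) -/
noncomputable def winProb {M K H B : Type*} [Fintype M] [MeasurableSpace K] [Fintype H]
    [Fintype B] [DecidableEq B] (Q : QECM M K H) (A : Attack M K H B) : ℝ :=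
  ∫ k, (1 / (A.messages.card : ℝ)) *
    ∑ m ∈ A.messages, ((A.povm k m * A.channel (Q.cipher k m)).trace).re ∂Q.keyDist

/-- The one-copy `N`-message telegraphing value: the supremum of the winning probabilities of all
attacks on `N` messages whose channel is a measurement channel. For `N = 2` this is the
telegraphing-distinguishing value. -/
noncomputable def telegraphingValue {M K H : Type*} [Fintype M] [MeasurableSpace K] [Fintype H]
    [DecidableEq H] (N : ℕ) (Q : QECM M K H) : ℝ :=
  sSup {p : ℝ | ∃ (B : Type) (_ : Fintype B) (_ : DecidableEq B) (A : Attack M K H B),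
    A.messages.card = N ∧ IsMeasurementChannel A.channel ∧ p = winProb Q A}

/-! ### The Haar measure on the unitary group -/

noncomputable instance unitaryGroupMeasurableSpace (d : ℕ) : MeasurableSpace (unitaryGroup (Fin d) ℂ) := borel _

instance unitaryGroupBorelSpace (d : ℕ) : BorelSpace (unitaryGroup (Fin d) ℂ) := ⟨rfl⟩

instance unitaryGroupCompactSpace (d : ℕ) : CompactSpace (unitaryGroup (Fin d) ℂ) := by
  have hc : IsCompact (Set.pi Set.univ fun _ : Fin d => Set.pi Set.univ fun _ : Fin d =>
      Metric.closedBall (0 : ℂ) 1) :=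
    isCompact_univ_pi fun _ => isCompact_univ_pi fun _ => isCompact_closedBall _ _
  have hcl : IsClosed (unitaryGroup (Fin d) ℂ : Set (Matrix (Fin d) (Fin d) ℂ)) := by
    have : (unitaryGroup (Fin d) ℂ : Set (Matrix (Fin d) (Fin d) ℂ)) =
        {U | U * star U = 1} := by
      ext U
      exact mem_unitaryGroup_iff
    rw [this]
    exact isClosed_eq (continuous_id.mul continuous_star) continuous_const
  refine isCompact_iff_compactSpace.mp (hc.of_isClosed_subset hcl ?_)
  intro U hU i _ j _
  simpa using entry_norm_bound_of_unitary hU i j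

/-- The Haar probability measure on `U(d)`. -/
noncomputable def haarUnitary (d : ℕ) : Measure (unitaryGroup (Fin d) ℂ) :=
  Measure.haarMeasure ⊤

instance haarUnitaryIsProbabilityMeasure (d : ℕ) : IsProbabilityMeasure (haarUnitary d) :=
  ⟨Measure.haarMeasure_self (K₀ := ⊤)⟩

/-! ### Haar-measure encryption -/

/-- `σ_i = (1/r) ∑_{j = ri}^{r(i+1)-1} |j⟩⟨j|` on `ℂ^{rn}`. -/
noncomputable def blockState (n r : ℕ) (i : Fin n) : Matrix (Fin (r * n)) (Fin (r * n)) ℂ :=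
  (1 / (r : ℂ)) • ∑ j ∈ Finset.univ.filter (fun j : Fin (r * n) =>
    r * (i : ℕ) ≤ (j : ℕ) ∧ (j : ℕ) < r * ((i : ℕ) + 1)), Matrix.single j j (1 : ℂ)

theorem blockState_isQuantumState (n r : ℕ) [NeZero r] (i : Fin n) :
    IsQuantumState (blockState n r i) := by
  constructor
  · unfold blockState
    refine PosSemidef.smul (posSemidef_sum (R := ℂ) _ fun j _ => ?_) ?_
    · rw [← Matrix.diagonal_single]
      refine PosSemidef.diagonal fun k => ?_
      by_cases h : k = j
      · subst h; simp
      · simp [h]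
    · have : (0 : ℝ) ≤ 1 / r := by positivity
      have h : (0 : ℂ) ≤ ((1 / r : ℝ) : ℂ) := by exact_mod_cast this
      simpa using h
  · have hcard : (Finset.univ.filter fun j : Fin (r * n) =>
        r * (i : ℕ) ≤ (j : ℕ) ∧ (j : ℕ) < r * (i + 1)).card = r := by
      have hle : r * ((i : ℕ) + 1) ≤ r * n := Nat.mul_le_mul_left _ i.2
      rw [← Finset.card_map Fin.valEmbedding]
      have : (Finset.univ.filter fun j : Fin (r * n) =>
          r * (i : ℕ) ≤ (j : ℕ) ∧ (j : ℕ) < r * (i + 1)).map Fin.valEmbedding =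
          Finset.Ico (r * (i : ℕ)) (r * (i + 1)) := by
        ext x
        simp only [Finset.mem_map, Finset.mem_filter, Finset.mem_univ, true_and,
          Fin.valEmbedding_apply, Finset.mem_Ico]
        constructor
        · rintro ⟨j, hj, rfl⟩
          exact hj
        · intro hx
          exact ⟨⟨x, lt_of_lt_of_le hx.2 hle⟩, hx, rfl⟩
      rw [this, Nat.card_Ico, Nat.mul_add, mul_one, Nat.add_sub_cancel_left]
    have hr : (r : ℂ) ≠ 0 := by exact_mod_cast NeZero.ne r
    unfold blockState
    rw [trace_smul, trace_sum]
    simp [hcard, hr]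

/-- The rank-`r` Haar-measure encryption of `n` messages: the key is a Haar-random
`U ∈ U(rn)` and the ciphertext of `i` is `U σ_i U*`. -/
noncomputable def haarEncryption (n r : ℕ) [NeZero r] :
    QECM (Fin n) (unitaryGroup (Fin (r * n)) ℂ) (Fin (r * n)) where
  keyDist := haarUnitary (r * n)
  isProbabilityMeasure := inferInstance
  cipher U i := (U : Matrix (Fin (r * n)) (Fin (r * n)) ℂ) * blockState n r i *
    (U : Matrix (Fin (r * n)) (Fin (r * n)) ℂ)ᴴ
  isQuantumState U i := by
    refine ⟨(blockState_isQuantumState n r i).posSemidef.mul_mul_conjTranspose_same _, ?_⟩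
    have hU : (U : Matrix (Fin (r * n)) (Fin (r * n)) ℂ)ᴴ *
        (U : Matrix (Fin (r * n)) (Fin (r * n)) ℂ) = 1 := mem_unitaryGroup_iff'.mp U.2
    rw [trace_mul_comm, ← mul_assoc, hU, one_mul]
    exact (blockState_isQuantumState n r i).trace_eq_one
  measurable_cipher m i j := by
    refine Continuous.measurable ?_
    have h : Continuous fun U : unitaryGroup (Fin (r * n)) ℂ =>
        (U : Matrix (Fin (r * n)) (Fin (r * n)) ℂ) * blockState n r m *
          (U : Matrix (Fin (r * n)) (Fin (r * n)) ℂ)ᴴ :=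
      (continuous_subtype_val.matrix_mul continuous_const).matrix_mul
        continuous_subtype_val.matrix_conjTranspose
    exact h.matrix_elem i j

/-! ### The computational-basis attack on the encryption of a bit -/

/-- Measurement in the computational basis, `Φ(ρ) = ∑ᵢ |i⟩⟨i| ρ |i⟩⟨i|`. -/
noncomputable def basisMeasurement (H : Type*) [Fintype H] [DecidableEq H] :
    Matrix H H ℂ →ₗ[ℂ] Matrix H H ℂ where
  toFun ρ := ∑ i, Matrix.single i i (1 : ℂ) * ρ * Matrix.single i i (1 : ℂ)
  map_add' ρ ρ' := by simp only [mul_add, add_mul, Finset.sum_add_distrib]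
  map_smul' c ρ := by
    simp only [Matrix.mul_smul, Matrix.smul_mul, Finset.smul_sum, RingHom.id_apply]

theorem basisMeasurement_eq_diagonal {H : Type*} [Fintype H] [DecidableEq H] (ρ : Matrix H H ℂ) :
    basisMeasurement H ρ = Matrix.diagonal fun i => ρ i i := by
  ext a b
  simp only [basisMeasurement, LinearMap.coe_mk, AddHom.coe_mk, Matrix.sum_apply,
    Matrix.diagonal_apply]
  simp [Matrix.single_mul_mul_single, Matrix.single_apply]
  split_ifs with h
  · subst h
    simp
  · exact Finset.sum_eq_zero fun x _ => if_neg fun h' => h (h'.1.symm.trans h'.2)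

theorem basisMeasurement_isQuantumChannel (H : Type*) [Fintype H] [DecidableEq H] :
    IsQuantumChannel (basisMeasurement H) := by
  constructor
  · intro k X hX
    have key : tensorId (basisMeasurement H) k X =
        ∑ i : H, (Matrix.diagonal fun p : H × Fin k => if p.1 = i then (1 : ℂ) else 0) * X *
          (Matrix.diagonal fun p : H × Fin k => if p.1 = i then (1 : ℂ) else 0)ᴴ := by
      ext p q
      simp only [tensorId, basisMeasurement_eq_diagonal, Matrix.of_apply, Matrix.diagonal_apply,
        Matrix.sum_apply, Matrix.diagonal_conjTranspose, Matrix.mul_diagonal,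
        Matrix.diagonal_mul, Pi.star_apply]
      by_cases h : p.1 = q.1
      · rw [Finset.sum_eq_single p.1]
        · rw [if_pos h, if_pos rfl, if_pos h.symm]
          have hq : (p.1, q.2) = q := Prod.ext h rfl
          simp [hq]
        · intro b _ hb
          simp [hb.symm]
        · simp
      · rw [if_neg h]
        symm
        refine Finset.sum_eq_zero fun i _ => ?_
        by_cases hp : p.1 = i
        · have : q.1 ≠ i := fun hq => h (hp.trans hq.symm)
          simp [this]
        · simp [hp]
    rw [key]
    exact posSemidef_sum _ fun i _ => hX.mul_mul_conjTranspose_same _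
  · intro ρ
    rw [basisMeasurement_eq_diagonal, Matrix.trace_diagonal]
    rfl

open Classical in
/-- `G_{0,U} = {i | ⟨i|Uσ₀U*|i⟩ ≥ ⟨i|Uσ₁U*|i⟩}` and `G_{1,U}` is its complement. -/
noncomputable def guessSet (r : ℕ) [NeZero r] (U : unitaryGroup (Fin (r * 2)) ℂ) (b : Fin 2) :
    Finset (Fin (r * 2)) :=
  let G₀ := Finset.univ.filter fun i =>
    ((haarEncryption 2 r).cipher U 0 i i).re ≥ ((haarEncryption 2 r).cipher U 1 i i).re
  if b = 0 then G₀ else G₀ᶜ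

/-- `P^U_b = ∑_{i ∈ G_{b,U}} |i⟩⟨i|`. -/
noncomputable def guessPOVM (r : ℕ) [NeZero r] (U : unitaryGroup (Fin (r * 2)) ℂ) (b : Fin 2) :
    Matrix (Fin (r * 2)) (Fin (r * 2)) ℂ :=
  ∑ i ∈ guessSet r U b, Matrix.single i i (1 : ℂ)

theorem guessPOVM_isPOVM (r : ℕ) [NeZero r] (U : unitaryGroup (Fin (r * 2)) ℂ) :
    IsPOVM Finset.univ (guessPOVM r U) := by
  classical
  constructor
  · intro b _
    refine posSemidef_sum _ fun j _ => ?_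
    rw [← Matrix.diagonal_single]
    refine PosSemidef.diagonal fun k => ?_
    by_cases h : k = j
    · subst h; simp
    · simp [h]
  · have h : guessSet r U 1 = (guessSet r U 0)ᶜ := by simp [guessSet]
    rw [Fin.sum_univ_two, guessPOVM, guessPOVM, h, Finset.sum_add_sum_compl]
    exact Matrix.sum_single_one

theorem guessPOVM_measurable (r : ℕ) [NeZero r] (b : Fin 2) (i j : Fin (r * 2)) :
    Measurable fun U => guessPOVM r U b i j := by
  classical
  have hS : ∀ x, MeasurableSet {U | x ∈ guessSet r U b} := by
    intro x
    have h0 : MeasurableSet {U : unitaryGroup (Fin (r * 2)) ℂ |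
        ((haarEncryption 2 r).cipher U 1 x x).re ≤ ((haarEncryption 2 r).cipher U 0 x x).re} :=
      measurableSet_le (Complex.measurable_re.comp ((haarEncryption 2 r).measurable_cipher 1 x x))
        (Complex.measurable_re.comp ((haarEncryption 2 r).measurable_cipher 0 x x))
    by_cases hb : b = 0
    · simpa [guessSet, hb] using h0
    · convert h0.compl using 1
      ext U
      simp [guessSet, hb]
  have : (fun U => guessPOVM r U b i j) = fun U =>
      ∑ x, if x ∈ guessSet r U b then Matrix.single x x (1 : ℂ) i j else 0 := by
    funext U
    rw [guessPOVM, Matrix.sum_apply, Finset.sum_ite_mem, Finset.univ_inter]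
  rw [this]
  exact Finset.measurable_sum _ fun x _ => Measurable.ite (hS x) measurable_const measurable_const

/-- The computational-basis measurement attack on the rank-`r` Haar-measure encryption of a bit. -/
noncomputable def basisAttack (r : ℕ) [NeZero r] :
    Attack (Fin 2) (unitaryGroup (Fin (r * 2)) ℂ) (Fin (r * 2)) (Fin (r * 2)) where
  messages := Finset.univ
  povm := guessPOVM r
  isPOVM := guessPOVM_isPOVM r
  measurable_povm b _ := guessPOVM_measurable r b
  channel := basisMeasurement (Fin (r * 2))
  isQuantumChannel := basisMeasurement_isQuantumChannel _

/-!
The best guess from the outcome `x` of a POVM `P` is the likelier bit, so an attack measuring `P`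
wins with probability at most `1/2 + 1/4 ∑ₓ |Tr (P_x (ρ₀ - ρ₁))|`, with equality for the
computational basis and its decoder. After averaging over the key, left invariance of the Haar
measure bounds the term of `P_x` by `Tr P_x` times the term of a basis projection. Since
`∑ₓ Tr P_x = d`, no measurement beats the basis. The term of a basis projection is the mean of
`|A - B| / r`, where `A` and `B` are the masses of the two halves of a uniform unit vector. The norm
of a Gaussian vector is independent of its direction. Up to a constant factor this turns `A` and `B`
into independent Gamma variables, and `E |A - B| = C(2r, r) / 4^r`, which Wallis' product estimates.
-/

/-! ### The mean absolute difference of two independent variables -/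

section MeanAbsoluteDifference

open Filter Topology

theorem integrable_sign_mul {α : Type*} [MeasurableSpace α] {μ : Measure α} {h f : α → ℝ}
    (hh : Measurable h) (hf : Integrable f μ) : Integrable (fun x => Real.sign (h x) * f x) μ := by
  have hsign : Measurable Real.sign :=
    Measurable.ite measurableSet_Iio measurable_const
      (Measurable.ite measurableSet_Ioi measurable_const measurable_const)
  refine hf.bdd_mul (c := 1) (hsign.comp hh).aestronglyMeasurable (.of_forall fun x => ?_)
  rcases Real.sign_apply_eq (h x) with hx | hx | hx <;> simp [hx]

theorem integral_Ioi_sign_sub_mul_deriv {g g' : ℝ → ℝ} {a t L : ℝ}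
    (hg : ∀ s ∈ Set.Ici a, HasDerivAt g (g' s) s) (hg' : IntegrableOn g' (Set.Ioi a))
    (hlim : Tendsto g atTop (𝓝 L)) (hat : a ≤ t) :
    ∫ s in Set.Ioi a, Real.sign (s - t) * g' s = L + g a - 2 * g t := by
  have hint : IntegrableOn (fun s => Real.sign (s - t) * g' s) (Set.Ioi a) :=
    integrable_sign_mul (measurable_id.sub_const t) hg'
  have hright : ∫ s in Set.Ioi t, Real.sign (s - t) * g' s = L - g t := by
    rw [setIntegral_congr_fun (g := g') measurableSet_Ioi fun s hs => by
      simp [Real.sign_of_pos (sub_pos.mpr hs)]]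
    exact integral_Ioi_of_hasDerivAt_of_tendsto' (fun s hs => hg s (hat.trans hs))
      (hg'.mono_set (Set.Ioi_subset_Ioi hat)) hlim
  have hleft : ∫ s in Set.Ioc a t, Real.sign (s - t) * g' s = g a - g t := by
    rw [integral_Ioc_eq_integral_Ioo, setIntegral_congr_fun (g := fun s => -g' s) measurableSet_Ioo
      fun s hs => by simp [Real.sign_of_neg (sub_neg.mpr hs.2)], integral_neg,
      ← integral_Ioc_eq_integral_Ioo, ← intervalIntegral.integral_of_le hat,
      intervalIntegral.integral_eq_sub_of_hasDerivAt
        (fun s hs => hg s (Set.uIcc_of_le hat ▸ hs).1)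
        ((intervalIntegrable_iff_integrableOn_Ioc_of_le hat).mpr
          (hg'.mono_set Set.Ioc_subset_Ioi_self)), neg_sub]
  rw [← Set.Ioc_union_Ioi_eq_Ioi hat, setIntegral_union (Set.Ioc_disjoint_Ioi le_rfl)
    measurableSet_Ioi (hint.mono_set Set.Ioc_subset_Ioi_self)
    (hint.mono_set (Set.Ioi_subset_Ioi hat)), hleft, hright]
  ring

theorem abs_sub_eq_sign_mul_of_monotoneOn {φ : ℝ → ℝ} {S : Set ℝ} (hφ : MonotoneOn φ S) {s t : ℝ}
    (hs : s ∈ S) (ht : t ∈ S) : |φ s - φ t| = Real.sign (s - t) * (φ s - φ t) := by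
  rcases lt_trichotomy s t with hst | rfl | hst
  · rw [Real.sign_of_neg (sub_neg.mpr hst),
      abs_of_nonpos (sub_nonpos.mpr (hφ hs ht hst.le)), neg_one_mul]
  · simp
  · rw [Real.sign_of_pos (sub_pos.mpr hst),
      abs_of_nonneg (sub_nonneg.mpr (hφ ht hs hst.le)), one_mul]

/- Writing the modulus as a signed difference, the two halves of `φ s - φ t = (φ s - c) - (φ t - c)`
contribute equally, and `(φ - c) w` integrates against the sign to boundary values of `g`. -/
theorem integral_abs_sub_mul_mul_of_hasDerivAt {φ w g : ℝ → ℝ} {a c : ℝ}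
    (hφ : MonotoneOn φ (Set.Ioi a)) (hw : IntegrableOn w (Set.Ioi a))
    (hφw : IntegrableOn (fun s => φ s * w s) (Set.Ioi a))
    (hg : ∀ s ∈ Set.Ici a, HasDerivAt g ((c - φ s) * w s) s) (hga : g a = 0)
    (hlim : Tendsto g atTop (𝓝 0)) :
    ∫ z : ℝ × ℝ, |φ z.1 - φ z.2| * (w z.1 * w z.2)
      ∂((volume.restrict (Set.Ioi a)).prod (volume.restrict (Set.Ioi a))) =
      4 * ∫ t in Set.Ioi a, g t * w t := by
  set ν : Measure ℝ := volume.restrict (Set.Ioi a)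
  set f : ℝ × ℝ → ℝ := fun z => Real.sign (z.1 - z.2) * ((c - φ z.1) * w z.1 * w z.2) with hf
  have hg' : Integrable (fun s => (c - φ s) * w s) ν :=
    ((hw.const_mul c).sub hφw).congr (.of_forall fun s => (sub_mul c (φ s) (w s)).symm)
  have hf_int : Integrable f (ν.prod ν) :=
    integrable_sign_mul (measurable_fst.sub measurable_snd) (hg'.mul_prod hw)
  have habs : ∀ᵐ z : ℝ × ℝ ∂(ν.prod ν),
      |φ z.1 - φ z.2| * (w z.1 * w z.2) = -(f z + f z.swap) := by
    rw [Measure.prod_restrict]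
    filter_upwards [ae_restrict_mem (measurableSet_Ioi.prod measurableSet_Ioi)] with z hz
    rw [abs_sub_eq_sign_mul_of_monotoneOn hφ hz.1 hz.2]
    simp only [hf, Prod.fst_swap, Prod.snd_swap]
    rw [← neg_sub z.1 z.2, Real.sign_neg]
    ring
  have hswap : Integrable (fun z => f z.swap) (ν.prod ν) := hf_int.swap
  have hinner : ∀ t ∈ Set.Ioi a, ∫ s, f (s, t) ∂ν = -2 * (g t * w t) := fun t ht => by
    simp only [hf, ← mul_assoc (Real.sign _) (_ * _)]
    rw [integral_mul_const, integral_Ioi_sign_sub_mul_deriv hg hg' hlim (le_of_lt ht), hga]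
    ring
  rw [integral_congr_ae habs, integral_neg, integral_add hf_int hswap, integral_prod_swap,
    integral_prod_symm f hf_int, setIntegral_congr_fun measurableSet_Ioi hinner,
    integral_const_mul]
  ring

end MeanAbsoluteDifference

/-! ### Two independent Gaussian vectors -/

section GaussianRadii

open Filter Topology Module

theorem integrableOn_pow_mul_exp_neg_mul_sq {b : ℝ} (hb : 0 < b) (k : ℕ) :
    IntegrableOn (fun s : ℝ => s ^ k * Real.exp (-b * s ^ 2)) (Set.Ioi 0) := by
  have hk : -1 < (k : ℝ) := by linarith [k.cast_nonneg (α := ℝ)]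
  simpa only [Real.rpow_natCast] using integrableOn_rpow_mul_exp_neg_mul_sq hb hk

theorem integral_pow_mul_exp_neg_mul_sq {b : ℝ} (hb : 0 < b) (k : ℕ) :
    ∫ s in Set.Ioi (0 : ℝ), s ^ k * Real.exp (-b * s ^ 2) =
      b ^ (-((k + 1) / 2 : ℝ)) / 2 * Real.Gamma ((k + 1) / 2) := by
  have hk : -1 < (k : ℝ) := by linarith [k.cast_nonneg (α := ℝ)]
  have h := integral_rpow_mul_exp_neg_mul_rpow two_pos hk hb
  simp only [Real.rpow_natCast, Real.rpow_two, neg_div] at h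
  rw [h]
  ring

theorem tendsto_pow_mul_exp_neg_sq_atTop (k : ℕ) :
    Tendsto (fun s : ℝ => s ^ k * Real.exp (-s ^ 2)) atTop (𝓝 0) := by
  have hexp : Tendsto (fun s : ℝ => Real.exp (-(1 / 2) * s)) atTop (𝓝 0) :=
    Real.tendsto_exp_atBot.comp (tendsto_id.const_mul_atTop_of_neg (by norm_num))
  simpa using (rpow_mul_exp_neg_mul_sq_isLittleO_exp_neg one_pos k).isBigO.trans_tendsto hexp

theorem abs_sq_sub_sq_le (a b : ℝ) : |a ^ 2 - b ^ 2| ≤ a ^ 2 + b ^ 2 :=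
  (abs_sub _ _).trans_eq (by rw [abs_sq, abs_sq])

theorem sq_add_sq_mul_exp_neg (a b : ℝ) :
    (a ^ 2 + b ^ 2) * Real.exp (-(a ^ 2 + b ^ 2)) =
      a ^ 2 * Real.exp (-a ^ 2) * (b ^ 0 * Real.exp (-b ^ 2)) +
        a ^ 0 * Real.exp (-a ^ 2) * (b ^ 2 * Real.exp (-b ^ 2)) := by
  rw [neg_add, Real.exp_add]
  ring

theorem integrable_abs_sq_sub_sq_mul_gaussian (k : ℕ) :
    Integrable (fun z : ℝ × ℝ => |z.1 ^ 2 - z.2 ^ 2| * Real.exp (-(z.1 ^ 2 + z.2 ^ 2)) *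
      (z.1 ^ k * z.2 ^ k))
      ((volume.restrict (Set.Ioi 0)).prod (volume.restrict (Set.Ioi 0))) := by
  have hw := integrableOn_pow_mul_exp_neg_mul_sq one_pos k
  have hw' := integrableOn_pow_mul_exp_neg_mul_sq one_pos (k + 2)
  refine ((hw'.mul_prod hw).add (hw.mul_prod hw')).mono' (by fun_prop) ?_
  rw [Measure.prod_restrict]
  filter_upwards [ae_restrict_mem (measurableSet_Ioi.prod measurableSet_Ioi)] with z hz
  have hz1 : 0 < z.1 := hz.1
  have hz2 : 0 < z.2 := hz.2
  rw [Real.norm_of_nonneg (by positivity)]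
  refine (mul_le_mul_of_nonneg_right (mul_le_mul_of_nonneg_right (abs_sq_sub_sq_le _ _)
    (Real.exp_nonneg _)) (by positivity)).trans_eq ?_
  rw [sq_add_sq_mul_exp_neg, Pi.add_apply, neg_one_mul, neg_one_mul]
  ring

theorem integral_abs_sq_sub_sq_mul_gaussian (k : ℕ) :
    ∫ z : ℝ × ℝ, |z.1 ^ 2 - z.2 ^ 2| * Real.exp (-(z.1 ^ 2 + z.2 ^ 2)) *
      (z.1 ^ k * z.2 ^ k)
      ∂((volume.restrict (Set.Ioi 0)).prod (volume.restrict (Set.Ioi 0))) =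
      k.factorial / 2 ^ (k + 1) := by
  have hw := integrableOn_pow_mul_exp_neg_mul_sq one_pos k
  have hw' := integrableOn_pow_mul_exp_neg_mul_sq one_pos (k + 2)
  simp only [neg_one_mul] at hw hw'
  have hderiv : ∀ s : ℝ, HasDerivAt (fun s => s ^ (k + 1) * Real.exp (-s ^ 2) / 2)
      (((k + 1) / 2 - s ^ 2) * (s ^ k * Real.exp (-s ^ 2))) s := fun s => by
    refine (((hasDerivAt_pow (k + 1) s).mul ((hasDerivAt_pow 2 s).fun_neg.exp)).div_const
      2).congr_deriv ?_
    simp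
    ring
  have hmul : ∀ t : ℝ, t ^ (k + 1) * Real.exp (-t ^ 2) / 2 * (t ^ k * Real.exp (-t ^ 2)) =
      2⁻¹ * (t ^ (2 * k + 1) * Real.exp (-2 * t ^ 2)) := fun t => by
    rw [show -2 * t ^ 2 = -t ^ 2 + -t ^ 2 by ring, Real.exp_add]
    ring
  have hfactor : ∀ z : ℝ × ℝ, |z.1 ^ 2 - z.2 ^ 2| * Real.exp (-(z.1 ^ 2 + z.2 ^ 2)) *
      (z.1 ^ k * z.2 ^ k) = |z.1 ^ 2 - z.2 ^ 2| *
        (z.1 ^ k * Real.exp (-z.1 ^ 2) * (z.2 ^ k * Real.exp (-z.2 ^ 2))) := fun z => by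
    rw [neg_add, Real.exp_add]
    ring
  simp only [hfactor]
  rw [integral_abs_sub_mul_mul_of_hasDerivAt (φ := fun s => s ^ 2)
    (w := fun s => s ^ k * Real.exp (-s ^ 2))
    (fun s hs t _ hst => pow_le_pow_left₀ (le_of_lt hs) hst 2) hw
    (hw'.congr_fun (fun s _ => by ring) measurableSet_Ioi) (fun s _ => hderiv s) (by simp)
    (by simpa using (tendsto_pow_mul_exp_neg_sq_atTop (k + 1)).div_const 2)]
  simp only [hmul]
  rw [integral_const_mul, integral_pow_mul_exp_neg_mul_sq two_pos]
  have hk : (((2 * k + 1 : ℕ) : ℝ) + 1) / 2 = (k + 1 : ℕ) := by push_cast; ring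
  rw [hk, Real.rpow_neg two_pos.le, Real.rpow_natCast, Nat.cast_succ, Real.Gamma_nat_eq_factorial]
  field_simp
  norm_num

variable {E : Type*} [NormedAddCommGroup E] [NormedSpace ℝ E] [FiniteDimensional ℝ E]
  [Nontrivial E] [MeasurableSpace E] [BorelSpace E] (μ : Measure E) [μ.IsAddHaarMeasure]

theorem integrable_norm_pow_mul_exp_neg_sq_norm (j : ℕ) :
    Integrable (fun x => ‖x‖ ^ j * Real.exp (-‖x‖ ^ 2)) μ := by
  refine (integrable_fun_norm_addHaar μ (f := fun s => s ^ j * Real.exp (-s ^ 2))).mpr ?_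
  refine (integrableOn_pow_mul_exp_neg_mul_sq one_pos (finrank ℝ E - 1 + j)).congr_fun
    (fun s _ => ?_) measurableSet_Ioi
  simp only [neg_one_mul, smul_eq_mul, pow_add, mul_assoc]

theorem integral_prod_fun_norm_addHaar {F : ℝ → ℝ → ℝ}
    (hF : Integrable (fun z : E × E => F ‖z.1‖ ‖z.2‖) (μ.prod μ))
    (hF' : Integrable
      (fun z : ℝ × ℝ => F z.1 z.2 * (z.1 ^ (finrank ℝ E - 1) * z.2 ^ (finrank ℝ E - 1)))
      ((volume.restrict (Set.Ioi 0)).prod (volume.restrict (Set.Ioi 0)))) :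
    ∫ z : E × E, F ‖z.1‖ ‖z.2‖ ∂(μ.prod μ) =
      (finrank ℝ E * μ.real (Metric.ball 0 1)) ^ 2 *
        ∫ z : ℝ × ℝ, F z.1 z.2 * (z.1 ^ (finrank ℝ E - 1) * z.2 ^ (finrank ℝ E - 1))
          ∂((volume.restrict (Set.Ioi 0)).prod (volume.restrict (Set.Ioi 0))) := by
  rw [integral_prod _ hF, integral_prod _ hF']
  have hinner : ∀ s, ∫ y, F s ‖y‖ ∂μ = _ := fun s => integral_fun_norm_addHaar μ (F s)
  have houter := integral_fun_norm_addHaar μ fun s => ∫ y, F s ‖y‖ ∂μ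
  rw [houter]
  simp only [hinner, nsmul_eq_mul, smul_eq_mul, ← integral_const_mul]
  congr! 4
  ring

theorem integral_norm_pow_mul_exp_neg_sq_norm (j : ℕ) :
    ∫ x, ‖x‖ ^ j * Real.exp (-‖x‖ ^ 2) ∂μ =
      finrank ℝ E * μ.real (Metric.ball 0 1) * (Real.Gamma ((finrank ℝ E + j) / 2) / 2) := by
  have hn : 1 ≤ finrank ℝ E := finrank_pos
  have hexp : ((finrank ℝ E - 1 + j : ℕ) + 1 : ℝ) = finrank ℝ E + j := by
    push_cast [hn]
    ring
  have h := integral_pow_mul_exp_neg_mul_sq one_pos (finrank ℝ E - 1 + j)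
  rw [hexp, Real.one_rpow] at h
  rw [integral_fun_norm_addHaar μ fun s => s ^ j * Real.exp (-s ^ 2)]
  simp only [nsmul_eq_mul, smul_eq_mul, ← mul_assoc, ← pow_add, ← neg_one_mul (_ ^ 2)]
  rw [h]
  ring

theorem integrable_prod_sq_norm_add_mul_gaussian :
    Integrable (fun z : E × E => (‖z.1‖ ^ 2 + ‖z.2‖ ^ 2) * Real.exp (-(‖z.1‖ ^ 2 + ‖z.2‖ ^ 2)))
      (μ.prod μ) := by
  have h0 := integrable_norm_pow_mul_exp_neg_sq_norm μ 0
  have h2 := integrable_norm_pow_mul_exp_neg_sq_norm μ 2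
  exact ((h2.mul_prod h0).add (h0.mul_prod h2)).congr
    (.of_forall fun z => (sq_add_sq_mul_exp_neg ‖z.1‖ ‖z.2‖).symm)

theorem integral_prod_sq_norm_add_mul_gaussian :
    ∫ z : E × E, (‖z.1‖ ^ 2 + ‖z.2‖ ^ 2) * Real.exp (-(‖z.1‖ ^ 2 + ‖z.2‖ ^ 2)) ∂(μ.prod μ) =
      (finrank ℝ E * μ.real (Metric.ball 0 1)) ^ 2 *
        (Real.Gamma (finrank ℝ E / 2 + 1) ^ 2 / finrank ℝ E) := by
  have h0 := integrable_norm_pow_mul_exp_neg_sq_norm μ 0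
  have h2 := integrable_norm_pow_mul_exp_neg_sq_norm μ 2
  have hn : (finrank ℝ E : ℝ) ≠ 0 := by exact_mod_cast (finrank_pos (R := ℝ) (M := E)).ne'
  have hGamma := Real.Gamma_add_one (div_ne_zero hn two_ne_zero)
  simp only [sq_add_sq_mul_exp_neg]
  rw [integral_add (h2.mul_prod h0) (h0.mul_prod h2),
    integral_prod_mul (fun x : E => ‖x‖ ^ 2 * Real.exp (-‖x‖ ^ 2))
      (fun y : E => ‖y‖ ^ 0 * Real.exp (-‖y‖ ^ 2)),
    integral_prod_mul (fun x : E => ‖x‖ ^ 0 * Real.exp (-‖x‖ ^ 2))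
      (fun y : E => ‖y‖ ^ 2 * Real.exp (-‖y‖ ^ 2)),
    integral_norm_pow_mul_exp_neg_sq_norm, integral_norm_pow_mul_exp_neg_sq_norm, Nat.cast_zero,
    add_zero, Nat.cast_ofNat, add_div _ (2 : ℝ) 2, div_self (two_ne_zero' ℝ), hGamma]
  field_simp
  ring

/- In dimension `n = 2r` the constant is the central binomial coefficient over `4 ^ r`. -/
theorem integral_abs_sq_norm_sub_sq_norm_mul_gaussian :
    ∫ z : E × E, |‖z.1‖ ^ 2 - ‖z.2‖ ^ 2| * Real.exp (-(‖z.1‖ ^ 2 + ‖z.2‖ ^ 2)) ∂(μ.prod μ) =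
      (finrank ℝ E).factorial / (2 ^ finrank ℝ E * Real.Gamma (finrank ℝ E / 2 + 1) ^ 2) *
        ∫ z : E × E, (‖z.1‖ ^ 2 + ‖z.2‖ ^ 2) * Real.exp (-(‖z.1‖ ^ 2 + ‖z.2‖ ^ 2))
          ∂(μ.prod μ) := by
  have hn : 1 ≤ finrank ℝ E := finrank_pos
  have h2D := integral_abs_sq_sub_sq_mul_gaussian (finrank ℝ E - 1)
  rw [Nat.sub_add_cancel hn] at h2D
  have hpolar := integral_prod_fun_norm_addHaar μ
    (F := fun s t => |s ^ 2 - t ^ 2| * Real.exp (-(s ^ 2 + t ^ 2)))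
    ((integrable_prod_sq_norm_add_mul_gaussian μ).mono' (by fun_prop) (.of_forall fun z => by
      rw [Real.norm_of_nonneg (by positivity)]
      exact mul_le_mul_of_nonneg_right (abs_sq_sub_sq_le _ _) (Real.exp_nonneg _)))
    (integrable_abs_sq_sub_sq_mul_gaussian _)
  rw [hpolar, integral_prod_sq_norm_add_mul_gaussian, h2D]
  have hfact : ((finrank ℝ E).factorial : ℝ) = finrank ℝ E * (finrank ℝ E - 1).factorial := by
    exact_mod_cast (Nat.mul_factorial_pred (by lia)).symm
  have : Real.Gamma (finrank ℝ E / 2 + 1) ≠ 0 := (Real.Gamma_pos_of_pos (by positivity)).ne'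
  rw [hfact]
  field_simp

end GaussianRadii

/-! ### Averaging over the unitary group -/

section HaarAverage

variable {d : ℕ}

instance unitaryGroupSecondCountable : SecondCountableTopology (unitaryGroup (Fin d) ℂ) :=
  have : SecondCountableTopology (Matrix (Fin d) (Fin d) ℂ) :=
    inferInstanceAs (SecondCountableTopology (Fin d → Fin d → ℂ))
  TopologicalSpace.Subtype.secondCountableTopology _

instance haarUnitaryIsMulLeftInvariant : (haarUnitary d).IsMulLeftInvariant :=
  inferInstanceAs (Measure.haarMeasure ⊤).IsMulLeftInvariant

/-- The `i`-th row of a unitary matrix, as a vector of the Hilbert space `ℂ^d`. -/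
noncomputable def unitaryRow (U : unitaryGroup (Fin d) ℂ) (i : Fin d) : EuclideanSpace ℂ (Fin d) :=
  WithLp.toLp 2 ((U : Matrix (Fin d) (Fin d) ℂ) i)

/-- The action `x ↦ x U` of a unitary matrix on row vectors. It is recorded as a real isometry
because it is used through its invariance of the volume and of real homogeneous functions. -/
noncomputable def unitaryVecMul (U : unitaryGroup (Fin d) ℂ) :
    EuclideanSpace ℂ (Fin d) ≃ₗᵢ[ℝ] EuclideanSpace ℂ (Fin d) :=
  let T := Unitary.linearIsometryEquiv
    ⟨toEuclideanCLM (𝕜 := ℂ) (U : Matrix (Fin d) (Fin d) ℂ)ᵀ,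
      Unitary.map_mem _ (UnitaryGroup.transpose U).2⟩
  ⟨T.toLinearEquiv.restrictScalars ℝ, T.norm_map⟩

theorem unitaryVecMul_apply (U : unitaryGroup (Fin d) ℂ) (x : EuclideanSpace ℂ (Fin d)) :
    unitaryVecMul U x = WithLp.toLp 2 (x.ofLp ᵥ* (U : Matrix (Fin d) (Fin d) ℂ)) := by
  rw [← mulVec_transpose]
  rfl

theorem unitaryVecMul_unitaryRow (U V : unitaryGroup (Fin d) ℂ) (i : Fin d) :
    unitaryVecMul U (unitaryRow V i) = unitaryRow (V * U) i :=
  unitaryVecMul_apply U _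

theorem continuous_unitaryRow (i : Fin d) :
    Continuous fun U : unitaryGroup (Fin d) ℂ => unitaryRow U i :=
  (PiLp.continuous_toLp 2 _).comp ((continuous_apply i).comp continuous_subtype_val)

theorem continuous_uncurry_unitaryVecMul :
    Continuous fun p : EuclideanSpace ℂ (Fin d) × unitaryGroup (Fin d) ℂ =>
      unitaryVecMul p.2 p.1 := by
  simp only [unitaryVecMul_apply]
  exact (PiLp.continuous_toLp 2 _).comp
    (((PiLp.continuous_ofLp 2 _).comp continuous_fst).matrix_vecMul
      (continuous_subtype_val.comp continuous_snd))

theorem exists_unitaryRow_eq (i : Fin d) {x : EuclideanSpace ℂ (Fin d)} (hx : ‖x‖ = 1) :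
    ∃ U : unitaryGroup (Fin d) ℂ, unitaryRow U i = x := by
  have hon : Orthonormal ℂ (({i} : Set (Fin d)).domRestrict fun _ => x) :=
    ⟨fun _ => hx, fun a b hab => absurd (Subsingleton.elim a b) hab⟩
  obtain ⟨b, hb⟩ := hon.exists_orthonormalBasis_extension_of_card_eq finrank_euclideanSpace
  refine ⟨UnitaryGroup.transpose
    ⟨_, (EuclideanSpace.basisFun (Fin d) ℂ).toMatrix_orthonormalBasis_mem_unitary b⟩, ?_⟩
  rw [← hb i rfl]
  rfl

theorem exists_norm_smul_unitaryRow_eq (i : Fin d) (x : EuclideanSpace ℂ (Fin d)) :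
    ∃ U : unitaryGroup (Fin d) ℂ, ‖x‖ • unitaryRow U i = x := by
  rcases eq_or_ne x 0 with rfl | hx
  · exact ⟨1, by simp⟩
  · obtain ⟨U, hU⟩ := exists_unitaryRow_eq i (norm_smul_inv_norm (𝕜 := ℝ) hx)
    exact ⟨U, by rw [hU]; exact smul_inv_smul₀ (norm_ne_zero_iff.mpr hx) x⟩

variable {k : ℕ} {F : EuclideanSpace ℂ (Fin d) → ℝ}

theorem integral_comp_unitaryVecMul_haarUnitary (hF : ∀ (c : ℝ) x, F (c • x) = c ^ k * F x)
    (i : Fin d) (x : EuclideanSpace ℂ (Fin d)) :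
    ∫ U, F (unitaryVecMul U x) ∂(haarUnitary d) =
      ‖x‖ ^ k * ∫ U, F (unitaryRow U i) ∂(haarUnitary d) := by
  obtain ⟨V, hV⟩ := exists_norm_smul_unitaryRow_eq i x
  have hrow : ∀ U, F (unitaryVecMul U x) = ‖x‖ ^ k * F (unitaryRow (V * U) i) := fun U => by
    rw [← unitaryVecMul_unitaryRow, ← hF, ← map_smul, hV]
  simp only [hrow, integral_const_mul]
  rw [integral_mul_left_eq_self (μ := haarUnitary d) fun U => F (unitaryRow U i)]

theorem exists_abs_le_mul_norm_pow_of_homogeneous (hFc : Continuous F)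
    (hF : ∀ (c : ℝ) x, F (c • x) = c ^ k * F x) (i : Fin d) :
    ∃ C, ∀ x, |F x| ≤ C * ‖x‖ ^ k := by
  obtain ⟨C, hC⟩ := isCompact_univ.exists_bound_of_continuousOn
    (hFc.comp (continuous_unitaryRow i)).continuousOn
  refine ⟨C, fun x => ?_⟩
  obtain ⟨U, hU⟩ := exists_norm_smul_unitaryRow_eq i x
  calc |F x| = |F (unitaryRow U i)| * ‖x‖ ^ k := by
        rw [mul_comm, ← abs_norm x, ← abs_pow, ← abs_mul, ← hF, hU]
    _ ≤ C * ‖x‖ ^ k := by gcongr; exact hC U (Set.mem_univ U)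

/- The Gaussian weight is unitarily invariant, so `x` may be replaced by `x U` and averaged. -/
theorem integral_mul_exp_neg_sq_norm_eq_mul_integral_haarUnitary (hFc : Continuous F)
    (hF : ∀ (c : ℝ) x, F (c • x) = c ^ k * F x) (i : Fin d) :
    ∫ x, F x * Real.exp (-‖x‖ ^ 2) =
      (∫ x : EuclideanSpace ℂ (Fin d), ‖x‖ ^ k * Real.exp (-‖x‖ ^ 2)) *
        ∫ U, F (unitaryRow U i) ∂(haarUnitary d) := by
  have : Nonempty (Fin d) := ⟨i⟩
  obtain ⟨C, hC⟩ := exists_abs_le_mul_norm_pow_of_homogeneous hFc hF i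
  have hint : Integrable (Function.uncurry fun (x : EuclideanSpace ℂ (Fin d))
      (U : unitaryGroup (Fin d) ℂ) => F (unitaryVecMul U x) * Real.exp (-‖x‖ ^ 2))
      (volume.prod (haarUnitary d)) := by
    refine ((integrable_norm_pow_mul_exp_neg_sq_norm volume k).const_mul C).mul_prod
      (integrable_const (1 : ℝ)) |>.mono' (Continuous.aestronglyMeasurable ?_) (.of_forall ?_)
    · exact (hFc.comp continuous_uncurry_unitaryVecMul).mul (by fun_prop)
    · rintro ⟨x, U⟩
      have h := hC (unitaryVecMul U x)
      rw [LinearIsometryEquiv.norm_map] at h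
      simp only [Function.uncurry, norm_mul, Real.norm_eq_abs, Real.abs_exp, mul_one, ← mul_assoc]
      gcongr
  have hinv (U : unitaryGroup (Fin d) ℂ) : ∫ x, F (unitaryVecMul U x) * Real.exp (-‖x‖ ^ 2) =
      ∫ x, F x * Real.exp (-‖x‖ ^ 2) := by
    simpa only [LinearIsometryEquiv.norm_map] using
      (unitaryVecMul U).measurePreserving.integral_comp
        (unitaryVecMul U).toHomeomorph.measurableEmbedding fun x => F x * Real.exp (-‖x‖ ^ 2)
  calc ∫ x, F x * Real.exp (-‖x‖ ^ 2)
      = ∫ U, (∫ x, F (unitaryVecMul U x) * Real.exp (-‖x‖ ^ 2)) ∂(haarUnitary d) := by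
        simp only [hinv, integral_const, probReal_univ, one_smul]
    _ = ∫ x, (∫ U, F (unitaryVecMul U x) * Real.exp (-‖x‖ ^ 2) ∂(haarUnitary d)) :=
        (integral_integral_swap hint).symm
    _ = _ := by
        simp only [integral_mul_const, integral_comp_unitaryVecMul_haarUnitary hF i]
        simp only [← integral_mul_const, mul_right_comm]

end HaarAverage

/-! ### The two halves of a row -/

section BlockSqNorm

/-- The squared norm `∑_j |x_j|²` of the `b`-th block `r b ≤ j < r (b + 1)` of a vector of
`ℂ^{rn}`: the quantity `r ⟨x|σ_b|x⟩`. -/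
noncomputable def blockSqNorm (n r : ℕ) (b : Fin n) (x : EuclideanSpace ℂ (Fin (r * n))) : ℝ :=
  ∑ j ∈ Finset.univ.filter (fun j : Fin (r * n) =>
    r * (b : ℕ) ≤ (j : ℕ) ∧ (j : ℕ) < r * ((b : ℕ) + 1)), ‖x j‖ ^ 2

theorem continuous_blockSqNorm (n r : ℕ) (b : Fin n) : Continuous (blockSqNorm n r b) := by
  unfold blockSqNorm
  fun_prop

theorem blockSqNorm_smul (n r : ℕ) (b : Fin n) (c : ℝ) (x : EuclideanSpace ℂ (Fin (r * n))) :
    blockSqNorm n r b (c • x) = c ^ 2 * blockSqNorm n r b x := by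
  simp only [blockSqNorm, PiLp.smul_apply, norm_smul, mul_pow, Real.norm_eq_abs, sq_abs,
    Finset.mul_sum]

/-- The isometry `ℂ^{2r} ≃ ℂ^r ⊕ ℂ^r` that cuts a vector into its two blocks. -/
noncomputable def halves (r : ℕ) : EuclideanSpace ℂ (Fin (r * 2)) ≃ₗᵢ[ℝ]
    WithLp 2 (EuclideanSpace ℂ (Fin r) × EuclideanSpace ℂ (Fin r)) :=
  (LinearIsometryEquiv.piLpCongrLeft 2 ℝ ℂ
    ((finCongr (mul_two r)).trans finSumFinEquiv.symm)).trans
    (PiLp.sumPiLpEquivProdLpPiLp (𝕜 := ℝ) 2 fun _ => ℂ)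

theorem halves_fst_apply {r : ℕ} (x : EuclideanSpace ℂ (Fin (r * 2))) (j : Fin r) :
    (halves r x).fst j = x ((Fin.castAdd r j).cast (mul_two r).symm) :=
  rfl

theorem halves_snd_apply {r : ℕ} (x : EuclideanSpace ℂ (Fin (r * 2))) (j : Fin r) :
    (halves r x).snd j = x ((Fin.natAdd r j).cast (mul_two r).symm) :=
  rfl

theorem sum_fin_mul_two {M : Type*} [AddCommMonoid M] {r : ℕ} (f : Fin (r * 2) → M) :
    ∑ j, f j = (∑ j : Fin r, f ((Fin.castAdd r j).cast (mul_two r).symm)) +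
      ∑ j : Fin r, f ((Fin.natAdd r j).cast (mul_two r).symm) := by
  rw [← (finCongr (mul_two r).symm).sum_comp, Fin.sum_univ_add]
  rfl

theorem norm_halves_fst_sq {r : ℕ} (x : EuclideanSpace ℂ (Fin (r * 2))) :
    ‖(halves r x).fst‖ ^ 2 = blockSqNorm 2 r 0 x := by
  have hlt (j : Fin r) : (j : ℕ) < r := j.2
  simp only [EuclideanSpace.norm_sq_eq, halves_fst_apply, blockSqNorm, Finset.sum_filter,
    sum_fin_mul_two]
  simp [hlt]

theorem norm_halves_snd_sq {r : ℕ} (x : EuclideanSpace ℂ (Fin (r * 2))) :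
    ‖(halves r x).snd‖ ^ 2 = blockSqNorm 2 r 1 x := by
  have hlt (j : Fin r) : ¬ r ≤ (j : ℕ) := by omega
  have hadd (j : Fin r) : r + (j : ℕ) < r * 2 := by omega
  simp only [EuclideanSpace.norm_sq_eq, halves_snd_apply, blockSqNorm, Finset.sum_filter,
    sum_fin_mul_two]
  simp [hlt, hadd, -Fin.natAdd_eq_addNat]

theorem sq_norm_eq_blockSqNorm_add {r : ℕ} (x : EuclideanSpace ℂ (Fin (r * 2))) :
    ‖x‖ ^ 2 = blockSqNorm 2 r 0 x + blockSqNorm 2 r 1 x := by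
  rw [← norm_halves_fst_sq, ← norm_halves_snd_sq, ← WithLp.prod_norm_sq_eq_of_L2,
    LinearIsometryEquiv.norm_map]

theorem integral_comp_norm_halves (r : ℕ) (g : ℝ → ℝ → ℝ) :
    ∫ x : EuclideanSpace ℂ (Fin (r * 2)), g (blockSqNorm 2 r 0 x) (blockSqNorm 2 r 1 x) =
      ∫ z : EuclideanSpace ℂ (Fin r) × EuclideanSpace ℂ (Fin r), g (‖z.1‖ ^ 2) (‖z.2‖ ^ 2) := by
  have hofLp := WithLp.volume_preserving_ofLp
    (EuclideanSpace ℂ (Fin r)) (EuclideanSpace ℂ (Fin r))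
  rw [← hofLp.integral_comp (MeasurableEquiv.toLp 2 _).symm.measurableEmbedding,
    ← (halves r).measurePreserving.integral_comp (halves r).toHomeomorph.measurableEmbedding]
  simp only [← norm_halves_fst_sq, ← norm_halves_snd_sq]
  rfl

open Module in
theorem integral_abs_blockSqNorm_sub_mul_gaussian (r : ℕ) [NeZero r] :
    ∫ x, |blockSqNorm 2 r 0 x - blockSqNorm 2 r 1 x| * Real.exp (-‖x‖ ^ 2) =
      r.centralBinom / 4 ^ r *
        ∫ x : EuclideanSpace ℂ (Fin (r * 2)), ‖x‖ ^ 2 * Real.exp (-‖x‖ ^ 2) := by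
  have hrank : finrank ℝ (EuclideanSpace ℂ (Fin r)) = 2 * r := by
    rw [finrank_real_of_complex, finrank_euclideanSpace_fin]
  have hGamma : Real.Gamma ((2 * r : ℕ) / 2 + 1) = r.factorial := by
    rw [← Real.Gamma_nat_eq_factorial]
    push_cast
    ring_nf
  have hbinom : ((2 * r).factorial : ℝ) / (2 ^ (2 * r) * (r.factorial : ℝ) ^ 2) =
      r.centralBinom / 4 ^ r := by
    rw [Nat.centralBinom_eq_two_mul_choose, Nat.cast_choose ℝ (by omega : r ≤ 2 * r),
      show 2 * r - r = r by omega, pow_mul]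
    norm_num
    ring
  have hsplit :=
    integral_abs_sq_norm_sub_sq_norm_mul_gaussian (volume : Measure (EuclideanSpace ℂ (Fin r)))
  rw [hrank, hGamma, hbinom, ← Measure.volume_eq_prod,
    ← integral_comp_norm_halves r fun s t => |s - t| * Real.exp (-(s + t)),
    ← integral_comp_norm_halves r fun s t => (s + t) * Real.exp (-(s + t))] at hsplit
  simpa only [← sq_norm_eq_blockSqNorm_add] using hsplit

theorem integral_abs_blockSqNorm_sub_unitaryRow {r : ℕ} [NeZero r] (i : Fin (r * 2)) :
    ∫ U, |blockSqNorm 2 r 0 (unitaryRow U i) - blockSqNorm 2 r 1 (unitaryRow U i)|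
      ∂(haarUnitary (r * 2)) = r.centralBinom / 4 ^ r := by
  have havg := integral_mul_exp_neg_sq_norm_eq_mul_integral_haarUnitary (k := 2)
    (F := fun x => |blockSqNorm 2 r 0 x - blockSqNorm 2 r 1 x|)
    ((continuous_blockSqNorm 2 r 0).sub (continuous_blockSqNorm 2 r 1)).abs
    (fun c x => by simp only [blockSqNorm_smul, ← mul_sub, abs_mul, abs_sq]) i
  rw [integral_abs_blockSqNorm_sub_mul_gaussian, mul_comm] at havg
  refine (mul_left_cancel₀ ?_ havg).symm
  have hball : 0 < volume.real (Metric.ball (0 : EuclideanSpace ℂ (Fin (r * 2))) 1) :=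
    ENNReal.toReal_pos (Metric.measure_ball_pos _ _ one_pos).ne' measure_ball_lt_top.ne
  have hrank := Module.finrank_pos (R := ℝ) (M := EuclideanSpace ℂ (Fin (r * 2)))
  rw [integral_norm_pow_mul_exp_neg_sq_norm]
  positivity

end BlockSqNorm

/-! ### The central binomial coefficient -/

section CentralBinom

theorem sq_centralBinom_div_four_pow_mul_wallis (r : ℕ) :
    ((r.centralBinom : ℝ) / 4 ^ r) ^ 2 * (Real.Wallis.W r * (2 * r + 1)) = 1 := by
  have hfactorial : ((2 * r).factorial : ℝ) = r.centralBinom * r.factorial ^ 2 := by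
    have h := Nat.choose_mul_factorial_mul_factorial (show r ≤ 2 * r by omega)
    rw [show 2 * r - r = r by omega, ← Nat.centralBinom_eq_two_mul_choose] at h
    rw [sq, ← mul_assoc]
    exact_mod_cast h.symm
  have hpow : (2 : ℝ) ^ (4 * r) = (4 ^ r) ^ 2 := by
    rw [← pow_mul, mul_comm r, pow_mul, pow_mul]
    norm_num
  have hcentral : (r.centralBinom : ℝ) ≠ 0 := mod_cast r.centralBinom_ne_zero
  rw [Real.Wallis.W_eq_factorial_ratio, hfactorial, hpow]
  field_simp

theorem inv_sqrt_le_centralBinom_div_four_pow (r : ℕ) :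
    (√(Real.pi * r + Real.pi / 2))⁻¹ ≤ r.centralBinom / 4 ^ r := by
  refine inv_le_of_inv_le₀ (by have := r.centralBinom_pos; positivity) (Real.le_sqrt_of_sq_le ?_)
  rw [inv_pow, inv_eq_of_mul_eq_one_right (sq_centralBinom_div_four_pow_mul_wallis r)]
  nlinarith [Real.Wallis.W_le r]

theorem centralBinom_div_four_pow_le_inv_sqrt {r : ℕ} (hr : r ≠ 0) :
    r.centralBinom / 4 ^ r ≤ (√(Real.pi * r))⁻¹ := by
  have : (0 : ℝ) < r := by positivity
  refine le_inv_of_le_inv₀ (by positivity) (Real.sqrt_le_iff.mpr ⟨by positivity, ?_⟩)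
  rw [inv_pow, inv_eq_of_mul_eq_one_right (sq_centralBinom_div_four_pow_mul_wallis r)]
  calc Real.pi * r
      ≤ (2 * r + 1) / (2 * r + 2) * (Real.pi / 2) * (2 * r + 1) := by
        rw [div_mul_div_comm, div_mul_eq_mul_div, le_div_iff₀ (by positivity)]
        nlinarith [Real.pi_pos]
    _ ≤ Real.Wallis.W r * (2 * r + 1) := by
        gcongr
        exact Real.Wallis.le_W r

theorem inv_sqrt_sub_inv_sqrt_add_le {x h : ℝ} (hx : 0 < x) (hh : 0 ≤ h) :
    (√x)⁻¹ - (√(x + h))⁻¹ ≤ h / (2 * x * √x) := by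
  have hle : √x ≤ √(x + h) := Real.sqrt_le_sqrt (by linarith)
  have hpos : 0 < √x := Real.sqrt_pos.mpr hx
  have : 0 < √(x + h) := hpos.trans_le hle
  calc (√x)⁻¹ - (√(x + h))⁻¹
      = (√(x + h) ^ 2 - √x ^ 2) / ((√(x + h) + √x) * √(x + h) * √x) := by field_simp; ring
    _ = h / ((√(x + h) + √x) * √(x + h) * √x) := by
        rw [Real.sq_sqrt (by linarith), Real.sq_sqrt hx.le, add_sub_cancel_left]
    _ ≤ h / ((√x + √x) * √x * √x) := by gcongr
    _ = h / (2 * x * √x) := by rw [← two_mul, mul_assoc 2, Real.mul_self_sqrt hx.le]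

theorem abs_centralBinom_div_four_pow_sub_inv_sqrt_le {r : ℕ} (hr : r ≠ 0) :
    |r.centralBinom / 4 ^ r - (√(Real.pi * r))⁻¹| ≤ (4 * r * √(Real.pi * r))⁻¹ := by
  have : (0 : ℝ) < r := by positivity
  rw [abs_sub_comm, abs_of_nonneg (sub_nonneg.mpr (centralBinom_div_four_pow_le_inv_sqrt hr))]
  calc (√(Real.pi * r))⁻¹ - r.centralBinom / 4 ^ r
      ≤ (√(Real.pi * r))⁻¹ - (√(Real.pi * r + Real.pi / 2))⁻¹ := by
        gcongr
        exact inv_sqrt_le_centralBinom_div_four_pow r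
    _ ≤ Real.pi / 2 / (2 * (Real.pi * r) * √(Real.pi * r)) :=
        inv_sqrt_sub_inv_sqrt_add_le (by positivity) (by positivity)
    _ = (4 * r * √(Real.pi * r))⁻¹ := by
        field_simp
        norm_num

end CentralBinom

/-! ### Guessing a bit from the outcome of a measurement -/

open Unitary (conjStarAlgAut)

section Measurement

theorem mul_add_mul_le_max {a b p q : ℝ} (hp : 0 ≤ p) (hq : 0 ≤ q) (hpq : p + q = 1) :
    p * a + q * b ≤ max a b :=
  calc p * a + q * b ≤ p * max a b + q * max a b := by
        gcongr
        exacts [le_max_left a b, le_max_right a b]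
    _ = max a b := by rw [← add_mul, hpq, one_mul]

theorem integral_half_mul_one_add_half_mul {K : Type*} [MeasurableSpace K]
    {μ : Measure K} [IsProbabilityMeasure μ] {f : K → ℝ} (hf : Integrable f μ) :
    ∫ k, 1 / 2 * (1 + 1 / 2 * f k) ∂μ = 1 / 2 + 1 / 4 * ∫ k, f k ∂μ := by
  rw [integral_const_mul, integral_add (integrable_const _) (hf.const_mul _), integral_const,
    integral_const_mul, probReal_univ, one_smul]
  ring

theorem trace_mul_eq_sum_eigenvalues_mul {𝕜 n : Type*} [RCLike 𝕜] [Fintype n] [DecidableEq n]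
    {P : Matrix n n 𝕜} (hP : P.IsHermitian) (X : Matrix n n 𝕜) :
    (P * X).trace = ∑ k, (hP.eigenvalues k : 𝕜) *
      conjStarAlgAut 𝕜 _ (star hP.eigenvectorUnitary) X k k := by
  have hspec := hP.spectral_theorem
  rw [Unitary.conjStarAlgAut_apply] at hspec
  conv_lhs => rw [hspec]
  rw [Matrix.mul_assoc, Matrix.mul_assoc, trace_mul_comm, Matrix.mul_assoc]
  simp only [trace, diag_apply, diagonal_mul, Function.comp_apply,
    Unitary.conjStarAlgAut_star_apply, Matrix.mul_assoc]

variable {H B : Type*} [Fintype H] [Fintype B]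

/-- The Born rule: the probability `Tr(Pρ)` of the outcome with effect `P` in the state `ρ`. -/
noncomputable def bornProb (P ρ : Matrix H H ℂ) : ℝ :=
  ((P * ρ).trace).re

/-- The `ℓ¹` norm `∑ₓ |Tr(P_x X)|` of the outcome statistics of the measurement `P`. At
`X = ρ - ρ'` it is the distance between the outcome distributions of `ρ` and `ρ'`. -/
noncomputable def measuredNorm (P : B → Matrix H H ℂ) (X : Matrix H H ℂ) : ℝ :=
  ∑ x, |bornProb (P x) X|

theorem bornProb_sub (P ρ ρ' : Matrix H H ℂ) :
    bornProb P (ρ - ρ') = bornProb P ρ - bornProb P ρ' := by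
  simp only [bornProb, Matrix.mul_sub, trace_sub, Complex.sub_re]

theorem measuredNorm_sub_eq_sum_abs (P : B → Matrix H H ℂ) (ρ ρ' : Matrix H H ℂ) :
    measuredNorm P (ρ - ρ') = ∑ x, |bornProb (P x) ρ - bornProb (P x) ρ'| := by
  simp only [measuredNorm, bornProb_sub]

theorem re_trace_mul_of_forall_eq_sum [DecidableEq B] {Φ : Matrix H H ℂ →ₗ[ℂ] Matrix B B ℂ}
    {P : B → Matrix H H ℂ} (hΦ : ∀ ρ, Φ ρ = ∑ x, (P x * ρ).trace • Matrix.single x x (1 : ℂ))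
    {Q : Matrix B B ℂ} (hQ : Q.IsHermitian) (ρ : Matrix H H ℂ) :
    ((Q * Φ ρ).trace).re = ∑ x, (Q x x).re * bornProb (P x) ρ := by
  rw [hΦ, Finset.mul_sum, trace_sum, Complex.re_sum]
  refine Finset.sum_congr rfl fun x _ => ?_
  rw [Matrix.mul_smul, trace_smul, trace_mul_single, MulOpposite.op_one, one_smul, smul_eq_mul,
    mul_comm, ← hQ.coe_re_apply_self x]
  exact Complex.re_ofReal_mul _ _

theorem bornProb_nonneg {P ρ : Matrix H H ℂ} (hP : P.PosSemidef) (hρ : ρ.PosSemidef) :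
    0 ≤ bornProb P ρ := by
  classical
  rw [bornProb, trace_mul_eq_sum_eigenvalues_mul hP.1, Complex.re_sum]
  exact Finset.sum_nonneg fun k _ => (mul_nonneg (hP.eigenvalues_nonneg k)
    (Complex.le_def.mp (hρ.mul_mul_conjTranspose_same _).diag_nonneg).1).trans_eq
    (Complex.re_ofReal_mul _ _).symm

variable [DecidableEq H]

theorem bornProb_single (i : H) (ρ : Matrix H H ℂ) :
    bornProb (Matrix.single i i 1) ρ = (ρ i i).re := by
  simp only [bornProb, trace_single_mul, one_smul]

theorem sum_bornProb_eq_one {P : B → Matrix H H ℂ} (hP : IsPOVM Finset.univ P)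
    {ρ : Matrix H H ℂ} (hρ : ρ.trace = 1) : ∑ x, bornProb (P x) ρ = 1 := by
  simp only [bornProb]
  rw [← Complex.re_sum, ← trace_sum, ← Finset.sum_mul, hP.sum_eq_one, one_mul, hρ, Complex.one_re]

theorem sum_max_bornProb {P : B → Matrix H H ℂ} (hP : IsPOVM Finset.univ P)
    {ρ ρ' : Matrix H H ℂ} (hρ : ρ.trace = 1) (hρ' : ρ'.trace = 1) :
    ∑ x, max (bornProb (P x) ρ) (bornProb (P x) ρ') = 1 + 1 / 2 * measuredNorm P (ρ - ρ') := by
  have hmax (a b : ℝ) : max a b = (a + b + |a - b|) / 2 := by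
    rw [eq_div_iff two_ne_zero, mul_comm, abs_sub_comm, ← two_nsmul_sup_eq_add_add_abs_sub,
      nsmul_eq_mul, Nat.cast_ofNat]
  simp only [hmax]
  rw [← Finset.sum_div, Finset.sum_add_distrib, Finset.sum_add_distrib,
    sum_bornProb_eq_one hP hρ, sum_bornProb_eq_one hP hρ', ← measuredNorm_sub_eq_sum_abs]
  ring

variable {K : Type*} [MeasurableSpace K]

theorem integrable_bornProb_cipher {M : Type*} [Fintype M] (Q : QECM M K H)
    {P : B → Matrix H H ℂ} (hP : IsPOVM Finset.univ P) (x : B) (m : M) :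
    Integrable (fun k => bornProb (P x) (Q.cipher k m)) Q.keyDist := by
  have := Q.isProbabilityMeasure
  have hmeas : Measurable fun k => bornProb (P x) (Q.cipher k m) := by
    simp only [bornProb, trace, diag_apply, Matrix.mul_apply]
    exact Complex.measurable_re.comp (Finset.measurable_sum _ fun i _ =>
      Finset.measurable_sum _ fun j _ => (Q.measurable_cipher m j i).const_mul _)
  have hnonneg (k : K) (y : B) : 0 ≤ bornProb (P y) (Q.cipher k m) :=
    bornProb_nonneg (hP.posSemidef y (Finset.mem_univ y)) (Q.isQuantumState k m).posSemidef
  refine Integrable.of_bound hmeas.aestronglyMeasurable 1 (.of_forall fun k => ?_)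
  rw [Real.norm_of_nonneg (hnonneg k x),
    ← sum_bornProb_eq_one hP (Q.isQuantumState k m).trace_eq_one]
  exact Finset.single_le_sum (fun y _ => hnonneg k y) (Finset.mem_univ x)

theorem integrable_measuredNorm_cipher_sub {M : Type*} [Fintype M] (Q : QECM M K H)
    {P : B → Matrix H H ℂ} (hP : IsPOVM Finset.univ P) (m m' : M) :
    Integrable (fun k => measuredNorm P (Q.cipher k m - Q.cipher k m')) Q.keyDist := by
  simp only [measuredNorm_sub_eq_sum_abs]
  exact integrable_finsetSum _ fun x _ =>
    ((integrable_bornProb_cipher Q hP x m).sub (integrable_bornProb_cipher Q hP x m')).abs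

variable [DecidableEq B]

theorem IsPOVM.re_apply_self_nonneg {M : Type*} {S : Finset M} {Q : M → Matrix B B ℂ}
    (hQ : IsPOVM S Q) {m : M} (hm : m ∈ S) (x : B) : 0 ≤ (Q m x x).re :=
  (Complex.le_def.mp (hQ.posSemidef m hm).diag_nonneg).1

theorem IsPOVM.sum_re_apply_self {M : Type*} {S : Finset M} {Q : M → Matrix B B ℂ}
    (hQ : IsPOVM S Q) (x : B) : ∑ m ∈ S, (Q m x x).re = 1 := by
  rw [← Complex.re_sum, ← Matrix.sum_apply, hQ.sum_eq_one, one_apply_eq, Complex.one_re]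

variable {Φ : Matrix H H ℂ →ₗ[ℂ] Matrix B B ℂ} {P : B → Matrix H H ℂ}

theorem sum_re_trace_povm_mul_le (hP : IsPOVM Finset.univ P)
    (hΦ : ∀ ρ, Φ ρ = ∑ x, (P x * ρ).trace • Matrix.single x x (1 : ℂ))
    {Q : Fin 2 → Matrix B B ℂ} (hQ : IsPOVM Finset.univ Q)
    {ρ : Fin 2 → Matrix H H ℂ} (hρ : ∀ b, (ρ b).trace = 1) :
    ∑ b, ((Q b * Φ (ρ b)).trace).re ≤ 1 + 1 / 2 * measuredNorm P (ρ 0 - ρ 1) :=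
  calc ∑ b, ((Q b * Φ (ρ b)).trace).re
      = ∑ x, ((Q 0 x x).re * bornProb (P x) (ρ 0) + (Q 1 x x).re * bornProb (P x) (ρ 1)) := by
        rw [Fin.sum_univ_two, Finset.sum_add_distrib,
          re_trace_mul_of_forall_eq_sum hΦ (hQ.posSemidef 0 (Finset.mem_univ 0)).1,
          re_trace_mul_of_forall_eq_sum hΦ (hQ.posSemidef 1 (Finset.mem_univ 1)).1]
    _ ≤ ∑ x, max (bornProb (P x) (ρ 0)) (bornProb (P x) (ρ 1)) := by
        refine Finset.sum_le_sum fun x _ => mul_add_mul_le_max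
          (hQ.re_apply_self_nonneg (Finset.mem_univ 0) x)
          (hQ.re_apply_self_nonneg (Finset.mem_univ 1) x) ?_
        rw [← Fin.sum_univ_two fun b => (Q b x x).re, hQ.sum_re_apply_self]
    _ = 1 + 1 / 2 * measuredNorm P (ρ 0 - ρ 1) := sum_max_bornProb hP (hρ 0) (hρ 1)

theorem winProb_le_of_forall_channel_eq (Q : QECM (Fin 2) K H) (A : Attack (Fin 2) K H B)
    (hcard : A.messages.card = 2) (hP : IsPOVM Finset.univ P)
    (hΦ : ∀ ρ, A.channel ρ = ∑ x, (P x * ρ).trace • Matrix.single x x (1 : ℂ)) :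
    winProb Q A ≤
      1 / 2 + 1 / 4 * ∫ k, measuredNorm P (Q.cipher k 0 - Q.cipher k 1) ∂Q.keyDist := by
  have := Q.isProbabilityMeasure
  have hmessages : A.messages = Finset.univ := Finset.eq_univ_of_card _ hcard
  have hpovm (k : K) : IsPOVM Finset.univ (A.povm k) := hmessages ▸ A.isPOVM k
  have hint := integrable_measuredNorm_cipher_sub Q hP 0 1
  have hnonneg (k : K) (b : Fin 2) :
      0 ≤ ((A.povm k b * A.channel (Q.cipher k b)).trace).re := by
    have hb := Finset.mem_univ b
    rw [re_trace_mul_of_forall_eq_sum hΦ ((hpovm k).posSemidef b hb).1]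
    exact Finset.sum_nonneg fun x _ => mul_nonneg ((hpovm k).re_apply_self_nonneg hb x)
      (bornProb_nonneg (hP.posSemidef x (Finset.mem_univ x)) (Q.isQuantumState k b).posSemidef)
  calc winProb Q A
      = ∫ k, 1 / 2 * ∑ b, ((A.povm k b * A.channel (Q.cipher k b)).trace).re ∂Q.keyDist := by
        rw [winProb, hcard, hmessages, Nat.cast_ofNat]
    _ ≤ ∫ k, 1 / 2 * (1 + 1 / 2 * measuredNorm P (Q.cipher k 0 - Q.cipher k 1)) ∂Q.keyDist := by
        refine integral_mono_of_nonneg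
          (.of_forall fun k =>
            mul_nonneg one_half_pos.le (Finset.sum_nonneg fun b _ => hnonneg k b))
          (((integrable_const _).add (hint.const_mul _)).const_mul _) (.of_forall fun k => ?_)
        exact mul_le_mul_of_nonneg_left (sum_re_trace_povm_mul_le hP hΦ (hpovm k)
          fun b => (Q.isQuantumState k b).trace_eq_one) one_half_pos.le
    _ = _ := integral_half_mul_one_add_half_mul hint

end Measurement

section BasisMeasurement

variable (H : Type*) [Fintype H] [DecidableEq H]

theorem isPOVM_single_self :
    IsPOVM Finset.univ fun i : H => Matrix.single i i (1 : ℂ) where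
  posSemidef i _ := by
    rw [← diagonal_single]
    exact PosSemidef.diagonal (Pi.single_nonneg.mpr zero_le_one)
  sum_eq_one := sum_single_one

theorem basisMeasurement_eq_sum (ρ : Matrix H H ℂ) :
    basisMeasurement H ρ =
      ∑ i, (Matrix.single i i 1 * ρ).trace • Matrix.single i i (1 : ℂ) := by
  simp only [trace_single_mul, smul_single, smul_eq_mul, mul_one, one_mul,
    basisMeasurement_eq_diagonal, sum_single_eq_diagonal]

theorem basisMeasurement_isMeasurementChannel : IsMeasurementChannel (basisMeasurement H) :=
  ⟨_, isPOVM_single_self H, basisMeasurement_eq_sum H⟩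

end BasisMeasurement

section BasisAttack

variable (r : ℕ) [NeZero r] (U : unitaryGroup (Fin (r * 2)) ℂ)

theorem mem_guessSet_zero {i : Fin (r * 2)} : i ∈ guessSet r U 0 ↔
    ((haarEncryption 2 r).cipher U 1 i i).re ≤ ((haarEncryption 2 r).cipher U 0 i i).re := by
  simp [guessSet]

theorem guessSet_one : guessSet r U 1 = (guessSet r U 0)ᶜ := by
  simp [guessSet]

theorem re_trace_guessPOVM_mul_basisMeasurement (b : Fin 2)
    (ρ : Matrix (Fin (r * 2)) (Fin (r * 2)) ℂ) :
    ((guessPOVM r U b * basisMeasurement (Fin (r * 2)) ρ).trace).re =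
      ∑ i ∈ guessSet r U b, (ρ i i).re := by
  simp only [guessPOVM, Finset.sum_mul, trace_sum, trace_single_mul, one_smul,
    basisMeasurement_eq_diagonal, diagonal_apply_eq, Complex.re_sum]

theorem sum_re_trace_guessPOVM_mul_basisMeasurement :
    ∑ b, ((guessPOVM r U b *
        basisMeasurement (Fin (r * 2)) ((haarEncryption 2 r).cipher U b)).trace).re =
      1 + 1 / 2 * measuredNorm (fun i => Matrix.single i i 1)
        ((haarEncryption 2 r).cipher U 0 - (haarEncryption 2 r).cipher U 1) := by
  have htrace (b : Fin 2) := ((haarEncryption 2 r).isQuantumState U b).trace_eq_one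
  rw [← sum_max_bornProb (isPOVM_single_self _) (htrace 0) (htrace 1)]
  simp only [bornProb_single]
  rw [Fin.sum_univ_two, re_trace_guessPOVM_mul_basisMeasurement,
    re_trace_guessPOVM_mul_basisMeasurement, guessSet_one,
    ← Finset.sum_add_sum_compl (guessSet r U 0)]
  congr 1
  · exact Finset.sum_congr rfl fun i hi => (max_eq_left ((mem_guessSet_zero r U).mp hi)).symm
  · refine Finset.sum_congr rfl fun i hi => (max_eq_right ?_).symm
    rw [Finset.mem_compl, mem_guessSet_zero, not_le] at hi
    exact hi.le

theorem winProb_basisAttack_eq_integral :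
    winProb (haarEncryption 2 r) (basisAttack r) =
      1 / 2 + 1 / 4 * ∫ U, measuredNorm (fun i => Matrix.single i i 1)
        ((haarEncryption 2 r).cipher U 0 - (haarEncryption 2 r).cipher U 1)
        ∂(haarEncryption 2 r).keyDist := by
  have := (haarEncryption 2 r).isProbabilityMeasure
  rw [← integral_half_mul_one_add_half_mul
    (integrable_measuredNorm_cipher_sub _ (isPOVM_single_self _) 0 1), winProb]
  simp only [← sum_re_trace_guessPOVM_mul_basisMeasurement]
  simp [basisAttack]

end BasisAttack

/-! ### Unitary averages of measurement statistics -/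

section UnitaryConjugation

variable {d : ℕ} (Z : Matrix (Fin d) (Fin d) ℂ)

theorem continuous_conjStarAlgAut_apply :
    Continuous fun U : unitaryGroup (Fin d) ℂ => conjStarAlgAut ℂ _ U Z :=
  (continuous_subtype_val.matrix_mul continuous_const).matrix_mul
    continuous_subtype_val.matrix_conjTranspose

theorem integrable_abs_bornProb_conj (P : Matrix (Fin d) (Fin d) ℂ) :
    Integrable (fun U => |bornProb P (conjStarAlgAut ℂ _ U Z)|) (haarUnitary d) :=
  (Complex.continuous_re.comp (continuous_const.matrix_mul
    (continuous_conjStarAlgAut_apply Z)).matrix_trace).abs.integrable_of_hasCompactSupport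
    (HasCompactSupport.of_compactSpace _)

theorem bornProb_eq_sum_eigenvalues_mul {P : Matrix (Fin d) (Fin d) ℂ} (hP : P.IsHermitian) :
    bornProb P Z = ∑ k, hP.eigenvalues k *
      bornProb (Matrix.single k k 1) (conjStarAlgAut ℂ _ (star hP.eigenvectorUnitary) Z) := by
  simp only [bornProb_single]
  rw [bornProb, trace_mul_eq_sum_eigenvalues_mul hP, Complex.re_sum]
  exact Finset.sum_congr rfl fun k _ => Complex.re_ofReal_mul _ _

variable {Z} {κ : ℝ}

/- Diagonalizing `P` by a unitary moves the key by left multiplication, which the Haar measure does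
not notice. -/
theorem integral_abs_bornProb_conj_le
    (hZ : ∀ i, ∫ U, |bornProb (Matrix.single i i 1) (conjStarAlgAut ℂ _ U Z)|
      ∂(haarUnitary d) ≤ κ)
    {P : Matrix (Fin d) (Fin d) ℂ} (hP : P.PosSemidef) :
    ∫ U, |bornProb P (conjStarAlgAut ℂ _ U Z)| ∂(haarUnitary d) ≤ P.trace.re * κ := by
  set V := star hP.1.eigenvectorUnitary
  set f : Fin d → unitaryGroup (Fin d) ℂ → ℝ := fun k U =>
    |bornProb (Matrix.single k k 1) (conjStarAlgAut ℂ _ U Z)|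
  have hf (k : Fin d) : Integrable (fun U => hP.1.eigenvalues k * f k (V * U)) (haarUnitary d) :=
    ((integrable_abs_bornProb_conj Z _).comp_mul_left V).const_mul _
  have htrace : P.trace.re = ∑ k, hP.1.eigenvalues k := by
    rw [hP.1.trace_eq_sum_eigenvalues, Complex.re_sum]
    rfl
  calc ∫ U, |bornProb P (conjStarAlgAut ℂ _ U Z)| ∂(haarUnitary d)
      ≤ ∫ U, ∑ k, hP.1.eigenvalues k * f k (V * U) ∂(haarUnitary d) := by
        refine integral_mono (integrable_abs_bornProb_conj Z P)
          (integrable_finsetSum _ fun k _ => hf k) fun U => ?_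
        simp only [bornProb_eq_sum_eigenvalues_mul _ hP.1, ← Unitary.conjStarAlgAut_mul_apply]
        refine (Finset.abs_sum_le_sum_abs _ _).trans_eq (Finset.sum_congr rfl fun k _ => ?_)
        rw [abs_mul, abs_of_nonneg (hP.eigenvalues_nonneg k)]
    _ = ∑ k, hP.1.eigenvalues k * ∫ U, f k U ∂(haarUnitary d) := by
        simp only [integral_finsetSum _ fun k _ => hf k, integral_const_mul,
          integral_mul_left_eq_self (μ := haarUnitary d)]
    _ ≤ P.trace.re * κ := by
        rw [htrace, Finset.sum_mul]
        exact Finset.sum_le_sum fun k _ =>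
          mul_le_mul_of_nonneg_left (hZ k) (hP.eigenvalues_nonneg k)

theorem integral_measuredNorm_conj_le
    (hZ : ∀ i, ∫ U, |bornProb (Matrix.single i i 1) (conjStarAlgAut ℂ _ U Z)|
      ∂(haarUnitary d) ≤ κ)
    {B : Type*} [Fintype B] {P : B → Matrix (Fin d) (Fin d) ℂ} (hP : IsPOVM Finset.univ P) :
    ∫ U, measuredNorm P (conjStarAlgAut ℂ _ U Z) ∂(haarUnitary d) ≤ d * κ := by
  have htrace : ∑ x, (P x).trace.re = d := by
    rw [← Complex.re_sum, ← trace_sum, hP.sum_eq_one, trace_one, Fintype.card_fin,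
      Complex.natCast_re]
  simp only [measuredNorm]
  rw [integral_finsetSum _ fun x _ => integrable_abs_bornProb_conj Z (P x), ← htrace,
    Finset.sum_mul]
  exact Finset.sum_le_sum fun x _ =>
    integral_abs_bornProb_conj_le hZ (hP.posSemidef x (Finset.mem_univ x))

theorem integral_measuredNorm_single_conj
    (hZ : ∀ i, ∫ U, |bornProb (Matrix.single i i 1) (conjStarAlgAut ℂ _ U Z)|
      ∂(haarUnitary d) = κ) :
    ∫ U, measuredNorm (fun i => Matrix.single i i 1) (conjStarAlgAut ℂ _ U Z)
      ∂(haarUnitary d) = d * κ := by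
  simp only [measuredNorm]
  rw [integral_finsetSum _ fun x _ => integrable_abs_bornProb_conj Z _]
  simp only [hZ, Finset.sum_const, Finset.card_univ, Fintype.card_fin, nsmul_eq_mul]

end UnitaryConjugation

section HaarEncryption

theorem blockState_eq_diagonal (n r : ℕ) (b : Fin n) :
    blockState n r b = diagonal fun j : Fin (r * n) =>
      if r * (b : ℕ) ≤ j ∧ (j : ℕ) < r * ((b : ℕ) + 1) then 1 / (r : ℂ) else 0 := by
  rw [blockState, Finset.smul_sum, Finset.sum_filter, ← sum_single_eq_diagonal]
  simp only [smul_single, smul_eq_mul, mul_one, apply_ite, single_zero]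

theorem bornProb_single_conj_blockState (n r : ℕ) (U : unitaryGroup (Fin (r * n)) ℂ)
    (b : Fin n) (i : Fin (r * n)) :
    bornProb (Matrix.single i i 1) (conjStarAlgAut ℂ _ U (blockState n r b)) =
      blockSqNorm n r b (unitaryRow U i) / r := by
  rw [bornProb_single, blockState_eq_diagonal, Unitary.conjStarAlgAut_apply, Matrix.mul_apply,
    Complex.re_sum, blockSqNorm, Finset.sum_div, Finset.sum_filter]
  refine Finset.sum_congr rfl fun j _ => ?_
  rw [mul_diagonal, star_apply, RCLike.star_def, mul_right_comm, Complex.mul_conj']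
  split_ifs
  · rw [mul_one_div]
    norm_cast
  · rw [mul_zero, Complex.zero_re]

variable (r : ℕ) [NeZero r]

theorem integral_abs_bornProb_single_conj_blockState_sub (i : Fin (r * 2)) :
    ∫ U, |bornProb (Matrix.single i i 1)
        (conjStarAlgAut ℂ _ U (blockState 2 r 0 - blockState 2 r 1))| ∂(haarUnitary (r * 2)) =
      r.centralBinom / 4 ^ r / r := by
  simp only [map_sub, bornProb_sub, bornProb_single_conj_blockState, ← sub_div,
    abs_div, Nat.abs_cast, integral_div, integral_abs_blockSqNorm_sub_unitaryRow]

theorem integral_measuredNorm_single_cipher_sub :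
    ∫ U, measuredNorm (fun i => Matrix.single i i 1)
        ((haarEncryption 2 r).cipher U 0 - (haarEncryption 2 r).cipher U 1)
        ∂(haarEncryption 2 r).keyDist = 2 * (r.centralBinom / 4 ^ r) := by
  have h := integral_measuredNorm_single_conj
    (integral_abs_bornProb_single_conj_blockState_sub r)
  simp only [map_sub] at h
  rwa [Nat.cast_mul, Nat.cast_ofNat, mul_comm (r : ℝ), mul_assoc,
    mul_div_cancel₀ _ (NeZero.ne (r : ℝ))] at h

theorem integral_measuredNorm_cipher_sub_le {B : Type*} [Fintype B]
    {P : B → Matrix (Fin (r * 2)) (Fin (r * 2)) ℂ} (hP : IsPOVM Finset.univ P) :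
    ∫ U, measuredNorm P ((haarEncryption 2 r).cipher U 0 - (haarEncryption 2 r).cipher U 1)
        ∂(haarEncryption 2 r).keyDist ≤ 2 * (r.centralBinom / 4 ^ r) := by
  have h := integral_measuredNorm_conj_le
    (fun i => (integral_abs_bornProb_single_conj_blockState_sub r i).le) hP
  simp only [map_sub] at h
  rwa [Nat.cast_mul, Nat.cast_ofNat, mul_comm (r : ℝ), mul_assoc,
    mul_div_cancel₀ _ (NeZero.ne (r : ℝ))] at h

theorem winProb_basisAttack : winProb (haarEncryption 2 r) (basisAttack r) =
    1 / 2 + 1 / 2 * (r.centralBinom / 4 ^ r) := by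
  rw [winProb_basisAttack_eq_integral, integral_measuredNorm_single_cipher_sub]
  ring

theorem winProb_haarEncryption_le {B : Type*} [Fintype B] [DecidableEq B]
    (A : Attack (Fin 2) (unitaryGroup (Fin (r * 2)) ℂ) (Fin (r * 2)) B)
    (hcard : A.messages.card = 2) (hA : IsMeasurementChannel A.channel) :
    winProb (haarEncryption 2 r) A ≤ 1 / 2 + 1 / 2 * (r.centralBinom / 4 ^ r) := by
  obtain ⟨P, hP, hΦ⟩ := hA
  linarith [winProb_le_of_forall_channel_eq (haarEncryption 2 r) A hcard hP hΦ,
    integral_measuredNorm_cipher_sub_le r hP]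

theorem telegraphingValue_haarEncryption : telegraphingValue 2 (haarEncryption 2 r) =
    1 / 2 + 1 / 2 * (r.centralBinom / 4 ^ r) := by
  refine IsGreatest.csSup_eq ⟨⟨Fin (r * 2), inferInstance, inferInstance, basisAttack r,
    Finset.card_fin 2, basisMeasurement_isMeasurementChannel _, (winProb_basisAttack r).symm⟩, ?_⟩
  rintro p ⟨B, _, _, A, hcard, hA, rfl⟩
  exact winProb_haarEncryption_le r A hcard hA

end HaarEncryption

section Bounds

theorem half_mul_centralBinom_div_four_pow (r : ℕ) :
    (1 / 2 * (r.centralBinom / 4 ^ r) : ℝ) = 1 / 2 ^ (2 * r + 1) * ((2 * r).choose r : ℝ) := by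
  rw [Nat.centralBinom_eq_two_mul_choose, pow_succ, pow_mul, show (2 : ℝ) ^ 2 = 4 by norm_num]
  field_simp

theorem abs_half_mul_centralBinom_sub_le {r : ℕ} (hr : r ≠ 0) :
    |1 / 2 * (r.centralBinom / 4 ^ r) - 1 / √(2 * Real.pi * (2 * r : ℝ))| ≤
      1 / (2 * r : ℝ) ^ (3 / 2 : ℝ) := by
  have : (0 : ℝ) < r := Nat.cast_pos.mpr (Nat.pos_of_ne_zero hr)
  have hsqrt : √(2 * Real.pi * (2 * r)) = 2 * √(Real.pi * r) := by
    rw [show 2 * Real.pi * (2 * (r : ℝ)) = 2 ^ 2 * (Real.pi * r) by ring,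
      Real.sqrt_mul (by positivity), Real.sqrt_sq two_pos.le]
  have hpow : (2 * r : ℝ) ^ (3 / 2 : ℝ) = 2 * r * √(2 * r) := by
    rw [show (3 / 2 : ℝ) = 1 + 1 / 2 by norm_num, Real.rpow_add (by positivity), Real.rpow_one,
      ← Real.sqrt_eq_rpow]
  calc |1 / 2 * (r.centralBinom / 4 ^ r) - 1 / √(2 * Real.pi * (2 * r : ℝ))|
      = 1 / 2 * |r.centralBinom / 4 ^ r - (√(Real.pi * r))⁻¹| := by
        rw [hsqrt, ← one_div_mul_one_div, one_div √_, ← mul_sub, abs_mul, abs_of_pos one_half_pos]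
    _ ≤ 1 / 2 * (4 * r * √(Real.pi * r))⁻¹ := by
        gcongr
        exact abs_centralBinom_div_four_pow_sub_inv_sqrt_le hr
    _ ≤ 1 * (2 * r * √(2 * r))⁻¹ := by
        gcongr
        exacts [by norm_num, by norm_num, Real.two_le_pi]
    _ = 1 / (2 * r : ℝ) ^ (3 / 2 : ℝ) := by rw [hpow, one_mul, one_div]

theorem centralBinom_div_four_pow_le_inv_sqrt_two_mul_add_one {r : ℕ} (hr : r ≠ 0) :
    r.centralBinom / 4 ^ r ≤ (√(2 * r + 1))⁻¹ := by
  have hr1 : (1 : ℝ) ≤ r := Nat.one_le_cast.mpr (Nat.one_le_iff_ne_zero.mpr hr)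
  refine (centralBinom_div_four_pow_le_inv_sqrt hr).trans ?_
  gcongr
  nlinarith [Real.pi_gt_three]

theorem sqrt_two_div_pi_mul_inv_sqrt_le_centralBinom_div_four_pow (r : ℕ) :
    √(2 / Real.pi) * (√(2 * r + 1))⁻¹ ≤ r.centralBinom / 4 ^ r := by
  refine le_of_eq_of_le ?_ (inv_sqrt_le_centralBinom_div_four_pow r)
  rw [← Real.sqrt_inv, ← Real.sqrt_inv, ← Real.sqrt_mul (by positivity)]
  congr 1
  field_simp

end Bounds

theorem mainTheorem6 :
    -- the attack is a telegraphing attack, and its exact winning probability, with `d = 2r`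
    (∀ (r : ℕ) [NeZero r],
      IsMeasurementChannel (basisAttack r).channel ∧
      winProb (haarEncryption 2 r) (basisAttack r) =
        1 / 2 + 1 / 2 ^ (2 * r + 1) * ((2 * r).choose r : ℝ)) ∧
    -- its asymptotics `1/2 + 1/√(2πd) + O(d^{-3/2})`
    (∃ C : ℝ, ∀ (r : ℕ) [NeZero r],
      |winProb (haarEncryption 2 r) (basisAttack r) -
          (1 / 2 + 1 / Real.sqrt (2 * Real.pi * (2 * r : ℝ)))| ≤
        C / (2 * r : ℝ) ^ (3 / 2 : ℝ)) ∧
    -- the one-copy upper bound on the telegraphing-distinguishing value ...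
    (∀ (r : ℕ) [NeZero r],
      winProb (haarEncryption 2 r) (basisAttack r) ≤ telegraphingValue 2 (haarEncryption 2 r) ∧
      telegraphingValue 2 (haarEncryption 2 r) ≤
        1 / 2 + 1 / (2 * Real.sqrt ((2 * r : ℝ) + 1))) ∧
    -- ... is tight in order
    (∃ c : ℝ, 0 < c ∧ ∀ (r : ℕ) [NeZero r],
      1 / 2 + c * (1 / (2 * Real.sqrt ((2 * r : ℝ) + 1))) ≤
        telegraphingValue 2 (haarEncryption 2 r)) := by
  refine ⟨fun r _ => ⟨basisMeasurement_isMeasurementChannel _, ?_⟩, ⟨1, fun r _ => ?_⟩,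
    fun r _ => ⟨?_, ?_⟩, ⟨√(2 / Real.pi), by positivity, fun r _ => ?_⟩⟩
  · rw [winProb_basisAttack, half_mul_centralBinom_div_four_pow]
  · rw [winProb_basisAttack, add_sub_add_left_eq_sub]
    exact abs_half_mul_centralBinom_sub_le (NeZero.ne r)
  · rw [telegraphingValue_haarEncryption, winProb_basisAttack]
  · rw [telegraphingValue_haarEncryption, ← one_div_mul_one_div, one_div √_]
    gcongr
    exact centralBinom_div_four_pow_le_inv_sqrt_two_mul_add_one (NeZero.ne r)
  · rw [telegraphingValue_haarEncryption, ← one_div_mul_one_div, mul_left_comm, one_div √_]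
    gcongr
    exact sqrt_two_div_pi_mul_inv_sqrt_le_centralBinom_div_four_pow r
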